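/- There are absolute constants $p\in(0,1)$ and $c>0$ such that for every $\varepsilon>0$ there is an $n_0=n_0(\varepsilon)$ such that for all $n\ge n_0$ the following holds. An instance of graphic TSP on $n$ vertices is the shortest-path metric $d$ of a connected unweighted graph on $\{1,\dots,n\}$; an instance of $(1,2)$-TSP is a metric $d$ on $\{1,\dots,n\}$ in which any two distinct points are at distance $1$ or $2$. A tour is a Hamiltonian cycle on all the points, and its cost is the sum of the $d$-lengths of its edges. A (randomized, adaptive) algorithm in the distance query model learns about $d$ only by querying pairs $(u,v)$, each query being answered by $d(u,v)$, and finally outputs a tour. Its number of queries on $d$ is counted in the worst case over its random seed, up to seeds of total probability zero. 1. Any algorithm that, on every instance $d$ of graphic TSP on $n$ vertices, outputs with probability at least $p$ a tour of cost at most $(2-\varepsilon)$ times the minimum cost of a tour, makes at least $c\,\varepsilon n^2$ queries on some instance of graphic TSP on $n$ vertices. 2. The same holds with $(1,2)$-TSP in place of graphic TSP. Moreover, the bounds already hold on average over the following random instances. For a permutation $\pi$ of $\{1,\dots,n\}$, let $G_\pi$ be its cycle graph, in which distinct $u,v$ are adjacent if and only if $\pi(u)=v$ or $\pi(v)=u$,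 and let $G_\pi^+$ be $G_\pi$ together with one more vertex that is adjacent to all the others (so $G_\pi^+$ has $n+1$ vertices). 3. Any algorithm whose output is a tour of cost at most $(2-\varepsilon)$ times the minimum with probability at least $p$, over its random seed and a uniformly random $\pi$, on the shortest-path metric of $G_\pi^+$, makes at least $c\,\varepsilon(n+1)^2$ queries for some $\pi$. 4. Any algorithm whose output is a tour of cost at most $(2-\varepsilon)$ times the minimum with probability at least $p$, over its random seed and a uniformly random $\pi$, on the $(1,2)$-metric in which the pairs at distance $1$ are the edges of $G_\pi$, makes at least $c\,\varepsilon n^2$ queries for some $\pi$. -/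

import Mathlib

namespace TSPQuery

/-! ## Tours -/

/-- The cost of the closed tour `σ 0, σ 1, …, σ (n - 1), σ 0` in the distance matrix `d`.
For `3 ≤ n`, the visiting orders `σ` describe exactly the Hamiltonian cycles on `n` points. -/
def tourCost {n : ℕ} (d : Fin n → Fin n → ℕ) (σ : Equiv.Perm (Fin n)) : ℕ :=
  ∑ i, d (σ i) (σ (finRotate n i))

/-- The minimum cost of a tour. -/
noncomputable def tspCost {n : ℕ} (d : Fin n → Fin n → ℕ) : ℕ :=
  ⨅ σ : Equiv.Perm (Fin n), tourCost d σ

/-- The tour `σ` is within a factor `ρ` of the optimum. -/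
def IsApproxTour {n : ℕ} (d : Fin n → Fin n → ℕ) (ρ : ℝ) (σ : Equiv.Perm (Fin n)) : Prop :=
  (tourCost d σ : ℝ) ≤ ρ * (tspCost d : ℝ)

/-! ## Instances -/

/-- `d` is an instance of `(1,2)`-TSP: a metric with all nonzero distances equal to `1` or `2`. -/
structure IsOneTwoMetric {n : ℕ} (d : Fin n → Fin n → ℕ) : Prop where
  self : ∀ u, d u u = 0
  symm : ∀ u v, d u v = d v u
  one_or_two : ∀ u v, u ≠ v → d u v = 1 ∨ d u v = 2

/-- `d` is an instance of graphic TSP: the shortest path metric of a connected graph. -/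
def IsGraphicMetric {n : ℕ} (d : Fin n → Fin n → ℕ) : Prop :=
  ∃ G : SimpleGraph (Fin n), G.Connected ∧ d = G.dist

open Classical in
/-- The `(1,2)`-metric whose pairs at distance `1` are the edges of `G`. -/
noncomputable def oneTwoDist {n : ℕ} (G : SimpleGraph (Fin n)) (u v : Fin n) : ℕ :=
  if u = v then 0 else if G.Adj u v then 1 else 2

/-- The cycle graph of a permutation `π`: distinct `u`, `v` are adjacent iff `π u = v` or
`π v = u`. -/
def permGraph {n : ℕ} (π : Equiv.Perm (Fin n)) : SimpleGraph (Fin n) :=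
  SimpleGraph.fromRel fun u v => π u = v

/-- The graph `G` (moved to the vertices `1, …, n`) with one more vertex `0` that is adjacent to
all the others. -/
def addHub {n : ℕ} (G : SimpleGraph (Fin n)) : SimpleGraph (Fin (n + 1)) :=
  SimpleGraph.fromRel fun u v =>
    u = 0 ∨ ∃ i j : Fin n, u = i.succ ∧ v = j.succ ∧ G.Adj i j

/-! ## Algorithms in the distance query model -/

/-- A deterministic adaptive algorithm on `n` points: it either stops and outputs a tour, or
queries the distance of a pair of points and continues depending on the answer. -/
inductive DetAlg (n : ℕ) : Type where
  | output (σ : Equiv.Perm (Fin n)) : DetAlg n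
  | query (u v : Fin n) (next : ℕ → DetAlg n) : DetAlg n

/-- The tour that the algorithm outputs on the distance matrix `d`. -/
def DetAlg.tour {n : ℕ} : DetAlg n → (Fin n → Fin n → ℕ) → Equiv.Perm (Fin n)
  | .output σ, _ => σ
  | .query u v next, d => (next (d u v)).tour d

/-- The number of distance queries that the algorithm makes on the distance matrix `d`. -/
def DetAlg.numQueries {n : ℕ} : DetAlg n → (Fin n → Fin n → ℕ) → ℕ
  | .output _, _ => 0
  | .query u v next, d => (next (d u v)).numQueries d + 1

/-- A randomized algorithm on `n` points: a random deterministic algorithm, where the random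
seed `ω` ranges over an arbitrary probability space. -/
structure RandAlg (n : ℕ) where
  Ω : Type*
  [mΩ : MeasurableSpace Ω]
  μ : MeasureTheory.Measure Ω
  [prob : MeasureTheory.IsProbabilityMeasure μ]
  run : Ω → DetAlg n
  measurable_tour : ∀ d σ, MeasurableSet {ω | (run ω).tour d = σ}
  measurable_numQueries : ∀ d k, MeasurableSet {ω | (run ω).numQueries d = k}

attribute [instance] RandAlg.mΩ RandAlg.prob

/-- The probability that `A`, on the distance matrix `d`, outputs a tour within a factor `ρ` of
the optimum. -/
noncomputable def RandAlg.successProb {n : ℕ} (A : RandAlg n) (d : Fin n → Fin n → ℕ)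
    (ρ : ℝ) : ℝ :=
  A.μ.real {ω | IsApproxTour d ρ ((A.run ω).tour d)}

/-- With positive probability, `A` makes at least `q` distance queries on `d`. In other words,
the worst-case number of queries of `A` on `d`, up to random seeds of probability zero, is at
least `q`. -/
def RandAlg.NeedsQueries {n : ℕ} (A : RandAlg n) (d : Fin n → Fin n → ℕ) (q : ℝ) : Prop :=
  0 < A.μ {ω | q ≤ ((A.run ω).numQueries d : ℝ)}

end TSPQuery

namespace TSPQuery

open Finset

/-! Averaging over the seeds reduces everything to a deterministic algorithm facing a uniformly
random permutation. Both kinds of random instance have the form `hubDist U π`, with `U` empty for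
(1,2)-TSP and `U` a single hub, fixed by `π`, for graphic TSP.

If `π` has few cycles, joining them up gives a tour on `N` points of cost close to `N`. A tour of
cost at most `2 - ε` times the optimum must then have nearly `ε N` edges of length 1. At most two of
these touch the hub; every other one is an arc of `π` in one of its two directions. Once a query is
replaced by two questions of the form "is `π u = v`?" and questions about all output edges are
appended, a successful run is a run of a decision tree with at least `k` positive answers, where `k`
is about `ε N / 32`.

Such runs are rare: by `ArcTree.card_found_le`, a tree asking at most `Q` questions finds `k` arcs
outside `U` for at most `Q.choose k * (N - #U - k)!` permutations. This is at most a fraction `2 ^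
(-k)` of the family as long as `Q` is below a constant times `k N`, that is, of order `ε N ^ 2`.

The number of cycles is handled through `numInvariant`: its mean over all permutations is exactly
one more than the number of points, so Markov's inequality bounds the exceptional permutations, and
it at least halves whenever two cycles are merged. -/

/-! ## Decision trees querying single arcs of a permutation -/

/-- A binary decision tree whose nodes ask whether `π u = v` for an unknown permutation `π`. -/
inductive ArcTree (n : ℕ) : Type where
  | leaf : ArcTree n
  | node (u v : Fin n) (yes no : ArcTree n) : ArcTree n

/-- The number of questions asked on the permutation `π`. -/
def ArcTree.depth {n : ℕ} : ArcTree n → Equiv.Perm (Fin n) → ℕ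
  | .leaf, _ => 0
  | .node u v yes no, π => (if π u = v then yes.depth π else no.depth π) + 1

/-- The points `u` whose image under `π` has been found by a positive answer. -/
def ArcTree.found {n : ℕ} : ArcTree n → Equiv.Perm (Fin n) → Finset (Fin n)
  | .leaf, _ => ∅
  | .node u v yes no, π => if π u = v then insert u (yes.found π) else no.found π

/-- A family of permutations that pairwise agree on `U` has at most `(n - #U)!` members. -/
theorem card_le_factorial_of_agree {n : ℕ} (F : Finset (Equiv.Perm (Fin n)))
    (U : Finset (Fin n)) (hF : ∀ π ∈ F, ∀ ρ ∈ F, ∀ u ∈ U, π u = ρ u) :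
    #F ≤ (n - #U).factorial := by
  classical
  rcases F.eq_empty_or_nonempty with rfl | ⟨ρ, hρ⟩
  · simp
  -- Relative to a fixed member `ρ`, every `ρ⁻¹ * π` fixes `U` pointwise, so it is a permutation of
  -- the complement.
  have hcard : Fintype.card {f : Equiv.Perm (Fin n) // ∀ a, ¬ a ∉ U → f a = a}
      = (n - #U).factorial := by
    rw [← Fintype.card_congr (Equiv.Perm.subtypeEquivSubtypePerm (fun a => a ∉ U)),
      Fintype.card_perm, Fintype.card_subtype_compl]
    simp
  rw [← hcard, ← Fintype.card_coe F]
  refine Fintype.card_le_of_injective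
    (fun π : F => ⟨ρ⁻¹ * π.1, fun a ha => ?_⟩) fun π π' h => ?_
  · rw [Equiv.Perm.mul_apply, hF π.1 π.2 ρ hρ a (not_not.mp ha)]
    simp
  · have := congrArg Subtype.val h
    exact Subtype.ext (mul_left_cancel this)

/-- Few permutations have many of their arcs found: such a permutation is encoded by the times of
its first `k` new positive answers and its values at the other points. -/
theorem ArcTree.card_found_le {n : ℕ} (T : ArcTree n) (F : Finset (Equiv.Perm (Fin n)))
    (U : Finset (Fin n)) (Q k : ℕ) (hF : ∀ π ∈ F, ∀ ρ ∈ F, ∀ u ∈ U, π u = ρ u) :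
    #{π ∈ F | T.depth π ≤ Q ∧ k ≤ #(T.found π \ U)} ≤ Q.choose k * (n - #U - k).factorial := by
  induction T generalizing F U Q k with
  | leaf =>
    cases k with
    | zero => simpa [ArcTree.depth] using card_le_factorial_of_agree F U hF
    | succ k => simp [ArcTree.found]
  | node u v yes no ihy ihn =>
    cases k with
    | zero =>
      simpa using (card_filter_le _ _).trans (card_le_factorial_of_agree F U hF)
    | succ k =>
    cases Q with
    | zero => simp [ArcTree.depth]
    | succ Q =>
    have hmono : Q.choose (k + 1) * (n - #U - (k + 1)).factorial ≤
        (Q + 1).choose (k + 1) * (n - #U - (k + 1)).factorial :=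
      Nat.mul_le_mul_right _ (Nat.choose_le_choose _ Q.le_succ)
    -- If `u ∈ U`, the whole family gives the same answer and the question is wasted: only one
    -- branch is reachable, and it has one question fewer.
    by_cases hu : u ∈ U
    · rcases F.eq_empty_or_nonempty with rfl | ⟨ρ, hρ⟩
      · simp
      by_cases hv : ρ u = v
      · refine (card_le_card fun π hπ => ?_).trans ((ihy F U Q (k + 1) hF).trans hmono)
        rw [mem_filter] at hπ ⊢
        have : π u = v := (hF π hπ.1 ρ hρ u hu).trans hv
        simpa [ArcTree.depth, ArcTree.found, this, insert_sdiff_of_mem _ hu] using hπ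
      · refine (card_le_card fun π hπ => ?_).trans ((ihn F U Q (k + 1) hF).trans hmono)
        rw [mem_filter] at hπ ⊢
        have : π u ≠ v := fun h => hv ((hF π hπ.1 ρ hρ u hu).symm.trans h)
        simpa [ArcTree.depth, ArcTree.found, this] using hπ
    -- A positive answer makes `u` a new point of agreement and leaves `k` arcs to find; a negative
    -- one still leaves `k + 1`. The two bounds add up by Pascal's rule.
    · have hsub : {π ∈ F | (node u v yes no).depth π ≤ Q + 1 ∧
            k + 1 ≤ #((node u v yes no).found π \ U)} ⊆
          {π ∈ F.filter (fun π => π u = v) | yes.depth π ≤ Q ∧ k ≤ #(yes.found π \ insert u U)} ∪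
          {π ∈ F | no.depth π ≤ Q ∧ k + 1 ≤ #(no.found π \ U)} := by
        intro π hπ
        rw [mem_filter] at hπ
        rw [mem_union, mem_filter, mem_filter, mem_filter]
        by_cases hv : π u = v
        · left
          obtain ⟨h1, h2, h3⟩ := hπ
          simp only [ArcTree.depth, ArcTree.found, hv, if_true] at h2 h3
          refine ⟨⟨h1, hv⟩, by omega, ?_⟩
          have : insert u (yes.found π) \ U ⊆ insert u (yes.found π \ insert u U) := by
            intro x
            simp only [mem_sdiff, mem_insert]
            tauto
          have := (card_le_card this).trans (card_insert_le _ _)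
          omega
        · right
          simpa [ArcTree.depth, ArcTree.found, hv] using hπ
      refine (card_le_card hsub).trans ((card_union_le _ _).trans ?_)
      have h1 := ihy (F.filter (fun π => π u = v)) (insert u U) Q k (by
        intro π hπ ρ hρ x hx
        rw [mem_filter] at hπ hρ
        rcases mem_insert.mp hx with rfl | hx
        · rw [hπ.2, hρ.2]
        · exact hF π hπ.1 ρ hρ.1 x hx)
      have h2 := ihn F U Q (k + 1) hF
      rw [card_insert_of_notMem hu, show n - (#U + 1) - k = n - #U - (k + 1) by omega] at h1
      rw [Nat.choose_succ_succ, add_mul]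
      exact add_le_add h1 h2

/-- The tree that asks the questions of a list. -/
def ArcTree.ofList {n : ℕ} : List (Fin n × Fin n) → ArcTree n
  | [] => .leaf
  | a :: l => .node a.1 a.2 (ofList l) (ofList l)

theorem ArcTree.depth_ofList {n : ℕ} (l : List (Fin n × Fin n)) (π : Equiv.Perm (Fin n)) :
    (ofList l).depth π = l.length := by
  induction l with
  | nil => rfl
  | cons a l ih => simp [ofList, depth, ih]

theorem ArcTree.mem_found_ofList {n : ℕ} (l : List (Fin n × Fin n)) (π : Equiv.Perm (Fin n))
    {u : Fin n} (h : (u, π u) ∈ l) : u ∈ (ofList l).found π := by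
  induction l with
  | nil => simp at h
  | cons a l ih =>
    rcases List.mem_cons.mp h with rfl | h
    · simp [ofList, found]
    · by_cases ha : π a.1 = a.2
      · simp [ofList, found, ha, ih h]
      · simp [ofList, found, ha, ih h]

/-! ## Distance matrices of permutations with hubs -/

/-- The distance of `x` and `y` in the cycle graph of a permutation to which the edges at all
points of `U` have been added, when `b` says whether one of `x`, `y` is the image of the other. -/
def hubAnswer {n : ℕ} (U : Finset (Fin n)) (x y : Fin n) (b : Bool) : ℕ :=
  if x = y then 0 else if x ∈ U ∨ y ∈ U ∨ b = true then 1 else 2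

/-- The distances in the cycle graph of `π` with hubs at the points of `U`, capped at `2`. -/
def hubDist {n : ℕ} (U : Finset (Fin n)) (π : Equiv.Perm (Fin n)) (x y : Fin n) : ℕ :=
  hubAnswer U x y (decide (π x = y ∨ π y = x))

/-- The questions about `π` that an algorithm asks on `hubDist U π`, followed by questions for
all edges of its output. -/
def DetAlg.toArcTree {n : ℕ} (U : Finset (Fin n)) : DetAlg n → ArcTree n
  | .output σ => .ofList ((List.finRange n).map (fun i => (σ i, σ (finRotate n i))) ++
      (List.finRange n).map (fun i => (σ (finRotate n i), σ i)))
  | .query x y next =>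
      .node x y ((next (hubAnswer U x y true)).toArcTree U)
        (.node y x ((next (hubAnswer U x y true)).toArcTree U)
          ((next (hubAnswer U x y false)).toArcTree U))

/-- A distance query costs at most two questions, one per direction of the arc; the final `2 * n`
questions test the output edges in both directions. -/
theorem DetAlg.depth_toArcTree_le {n : ℕ} (U : Finset (Fin n)) (T : DetAlg n)
    (π : Equiv.Perm (Fin n)) :
    (T.toArcTree U).depth π ≤ 2 * T.numQueries (hubDist U π) + 2 * n := by
  induction T with
  | output σ => simp [toArcTree, ArcTree.depth_ofList, numQueries]; omega
  | query x y next ih =>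
    have h := fun b => ih (hubAnswer U x y b)
    by_cases h1 : π x = y
    · have := h true
      simp only [toArcTree, ArcTree.depth, numQueries, hubDist, h1, true_or, decide_true,
        if_true] at this ⊢
      omega
    · by_cases h2 : π y = x
      · have := h true
        simp only [toArcTree, ArcTree.depth, numQueries, hubDist, h1, h2, or_true, decide_true,
          if_true, if_false] at this ⊢
        omega
      · have := h false
        simp only [toArcTree, ArcTree.depth, numQueries, hubDist, h1, h2, or_false, decide_false,
          if_false] at this ⊢
        omega

/-- The questions appended at the leaf guarantee that an arc used by the output counts as found even
if the algorithm merely guessed it. -/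
theorem DetAlg.mem_found_toArcTree {n : ℕ} (U : Finset (Fin n)) (T : DetAlg n)
    (π : Equiv.Perm (Fin n)) (i : Fin n) :
    (π (T.tour (hubDist U π) i) = T.tour (hubDist U π) (finRotate n i) →
      T.tour (hubDist U π) i ∈ (T.toArcTree U).found π) ∧
    (π (T.tour (hubDist U π) (finRotate n i)) = T.tour (hubDist U π) i →
      T.tour (hubDist U π) (finRotate n i) ∈ (T.toArcTree U).found π) := by
  induction T with
  | output σ =>
    simp only [toArcTree, tour]
    constructor <;> intro h <;> refine ArcTree.mem_found_ofList _ _ ?_ <;> rw [h] <;> simp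
  | query x y next ih =>
    have h := fun b => ih (hubAnswer U x y b)
    by_cases h1 : π x = y
    · have := h true
      simp only [toArcTree, ArcTree.found, tour, hubDist, h1, true_or, decide_true,
        if_true] at this ⊢
      exact ⟨fun h => mem_insert_of_mem (this.1 h), fun h => mem_insert_of_mem (this.2 h)⟩
    · by_cases h2 : π y = x
      · have := h true
        simp only [toArcTree, ArcTree.found, tour, hubDist, h1, h2, or_true, decide_true,
          if_true, if_false] at this ⊢
        exact ⟨fun h => mem_insert_of_mem (this.1 h), fun h => mem_insert_of_mem (this.2 h)⟩
      · have := h false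
        simp only [toArcTree, ArcTree.found, tour, hubDist, h1, h2, or_false, decide_false,
          if_false] at this ⊢
        exact this

theorem card_filter_mem_le {α β : Type*} [Fintype α] [DecidableEq β] {f : α → β}
    (hf : Function.Injective f) (A : Finset β) : #{i | f i ∈ A} ≤ #A :=
  card_le_card_of_injOn f (fun i hi => by simpa using hi) hf.injOn

/-- The number of edges of length `1` of the output is controlled by the number of arcs found. -/
theorem DetAlg.card_unit_edges_le {n : ℕ} (U : Finset (Fin n)) (T : DetAlg n)
    (π : Equiv.Perm (Fin n)) :
    #{i | hubDist U π (T.tour (hubDist U π) i) (T.tour (hubDist U π) (finRotate n i)) = 1} ≤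
      2 * #((T.toArcTree U).found π \ U) + 2 * #U := by
  set σ := T.tour (hubDist U π) with hσ
  set A := (T.toArcTree U).found π with hA
  -- An edge of length 1 has an endpoint in `U` or an endpoint that is the tail of a found arc; a
  -- point is an endpoint of only two tour positions, hence both factors 2.
  have hsub : ({i | hubDist U π (σ i) (σ (finRotate n i)) = 1} : Finset (Fin n)) ⊆
      (({i | σ i ∈ A \ U} : Finset (Fin n)) ∪
        ({i | (σ * finRotate n) i ∈ A \ U} : Finset (Fin n))) ∪
      (({i | σ i ∈ U} : Finset (Fin n)) ∪ ({i | (σ * finRotate n) i ∈ U} : Finset (Fin n))) := by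
    intro i hi
    have hf := T.mem_found_toArcTree U π i
    rw [← hσ, ← hA] at hf
    simp only [mem_filter_univ, mem_union, mem_sdiff] at hi ⊢
    simp only [Equiv.Perm.mul_apply]
    simp only [hubDist, hubAnswer] at hi
    split_ifs at hi with h1 h2
    · simp only [decide_eq_true_eq] at h2
      tauto
    · omega
  refine (card_le_card hsub).trans ((card_union_le _ _).trans ?_)
  have h1 := card_union_le ({i | σ i ∈ A \ U} : Finset (Fin n))
    ({i | (σ * finRotate n) i ∈ A \ U} : Finset (Fin n))
  have h2 := card_union_le ({i | σ i ∈ U} : Finset (Fin n))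
    ({i | (σ * finRotate n) i ∈ U} : Finset (Fin n))
  have h3 := card_filter_mem_le σ.injective (A \ U)
  have h4 := card_filter_mem_le (σ * finRotate n).injective (A \ U)
  have h5 := card_filter_mem_le σ.injective U
  have h6 := card_filter_mem_le (σ * finRotate n).injective U
  omega

/-! ## Permutations with few cycles have short tours -/

/-- The number of sets invariant under `π`, which is `2` to the number of cycles of `π`. -/
def numInvariant {n : ℕ} (π : Equiv.Perm (Fin n)) : ℕ :=
  #{A : Finset (Fin n) | ∀ x, π x ∈ A ↔ x ∈ A}

/-- These permutations form the stabilizer of the two-colouring of the points by membership in `A`.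
-/
theorem card_perm_preserving {n : ℕ} (A : Finset (Fin n)) :
    #{π : Equiv.Perm (Fin n) | ∀ x, π x ∈ A ↔ x ∈ A} =
      (#A).factorial * (n - #A).factorial := by
  have h := DomMulAct.stabilizer_card (fun x : Fin n => decide (x ∈ A))
  rw [Fintype.prod_bool, Fintype.card_subtype, Fintype.card_subtype, Fintype.card_subtype] at h
  have h1 : #{x : Fin n | decide (x ∈ A) = true} = #A := by simp
  have h2 : #{x : Fin n | decide (x ∈ A) = false} = n - #A := by
    have : ({x : Fin n | decide (x ∈ A) = false} : Finset (Fin n)) = Aᶜ := by ext; simp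
    rw [this, card_compl, Fintype.card_fin]
  rw [h1, h2] at h
  rw [← h]
  congr 1
  ext π
  simp [funext_iff]

/-- Double counting of pairs (permutation, invariant set): each set size from `0` to `n` contributes
`n.choose k * k! * (n - k)! = n!`. -/
theorem sum_numInvariant (n : ℕ) :
    ∑ π : Equiv.Perm (Fin n), numInvariant π = (n + 1) * n.factorial := by
  simp only [numInvariant, card_filter]
  rw [sum_comm]
  simp only [← card_filter, card_perm_preserving]
  rw [← powerset_univ,
    sum_powerset_apply_card (fun k => k.factorial * (n - k).factorial) (x := univ)]
  rw [card_univ, Fintype.card_fin, sum_congr rfl (g := fun _ => n.factorial), sum_const,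
    card_range, smul_eq_mul]
  intro k hk
  rw [smul_eq_mul, ← mul_assoc]
  exact Nat.choose_mul_factorial_mul_factorial (Nat.lt_succ_iff.mp (mem_range.mp hk))

/-- Markov's inequality for the number of invariant sets. -/
theorem card_large_numInvariant {n : ℕ} (F : Finset (Equiv.Perm (Fin n))) (K : ℕ) :
    #{π ∈ F | K ≤ numInvariant π} * K ≤ ∑ π ∈ F, numInvariant π := by
  rw [← smul_eq_mul, ← sum_const]
  exact (sum_le_sum fun π hπ => (mem_filter.mp hπ).2).trans
    (sum_le_sum_of_subset (filter_subset _ _))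

theorem one_lt_numInvariant {n : ℕ} (hn : 0 < n) (π : Equiv.Perm (Fin n)) :
    1 < numInvariant π := by
  refine one_lt_card.mpr ⟨∅, by simp, univ, by simp, ?_⟩
  have : Nonempty (Fin n) := ⟨⟨0, hn⟩⟩
  exact univ_nonempty.ne_empty.symm

/-- Multiplying by a transposition that merges two cycles keeps the cycles together. -/
theorem sameCycle_mul_swap {n : ℕ} {π : Equiv.Perm (Fin n)} {u w : Fin n}
    (h : ¬ π.SameCycle u w) : (π * Equiv.swap u w).SameCycle u w := by
  classical
  have hex : ∃ k, 0 < k ∧ (π ^ k) w = w :=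
    ⟨orderOf π, orderOf_pos π, by rw [pow_orderOf_eq_one]; rfl⟩
  obtain ⟨hk0, hk⟩ := Nat.find_spec hex
  have hmin := fun j => Nat.find_min hex (m := j)
  generalize Nat.find hex = k at *
  -- After its first step from `u`, the new permutation follows the `π`-cycle of `w`. Before the
  -- first return to `w` at time `k` it meets neither `w`, by minimality, nor `u`, which lies on
  -- another cycle.
  have key : ∀ j < k, ((π * Equiv.swap u w) ^ (j + 1)) u = (π ^ (j + 1)) w := by
    intro j
    induction j with
    | zero => intro _; simp
    | succ j ih =>
      intro hj
      rw [pow_succ', Equiv.Perm.mul_apply, ih (by omega), Equiv.Perm.mul_apply,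
        Equiv.swap_apply_of_ne_of_ne, pow_succ' π (j + 1), Equiv.Perm.mul_apply]
      · intro he
        exact h (Equiv.Perm.SameCycle.symm ⟨(j + 1 : ℕ), by rw [zpow_natCast, he]⟩)
      · intro he
        exact hmin (j + 1) hj ⟨by omega, he⟩
  refine ⟨(k : ℕ), ?_⟩
  have := key (k - 1) (by omega)
  rw [Nat.sub_add_cancel hk0, hk] at this
  rw [zpow_natCast, this]

theorem mem_iff_of_sameCycle {n : ℕ} {π : Equiv.Perm (Fin n)} {A : Finset (Fin n)}
    (hA : ∀ x, π x ∈ A ↔ x ∈ A) {u w : Fin n} (h : π.SameCycle u w) : u ∈ A ↔ w ∈ A := by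
  obtain ⟨k, hk⟩ := h.exists_nat_pow_eq
  rw [← hk]
  clear hk
  induction k with
  | zero => simp
  | succ k ih => rw [pow_succ', Equiv.Perm.mul_apply, hA, ← ih]

/-- Merging two cycles halves the number of invariant sets. -/
theorem two_mul_numInvariant_mul_swap_le {n : ℕ} {π : Equiv.Perm (Fin n)} {u w : Fin n}
    (h : ¬ π.SameCycle u w) : 2 * numInvariant (π * Equiv.swap u w) ≤ numInvariant π := by
  classical
  set C : Finset (Fin n) := {x | π.SameCycle u x} with hC
  have hCi : ∀ x, π x ∈ C ↔ x ∈ C := by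
    intro x
    simp [hC, Equiv.Perm.sameCycle_apply_right]
  set I' : Finset (Finset (Fin n)) := {A | ∀ x, (π * Equiv.swap u w) x ∈ A ↔ x ∈ A} with hI'
  have huw : ∀ A ∈ I', (u ∈ A ↔ w ∈ A) := fun A hA =>
    mem_iff_of_sameCycle ((mem_filter_univ A).mp hA) (sameCycle_mul_swap h)
  have hinv : ∀ A ∈ I', ∀ x, π x ∈ A ↔ x ∈ A := by
    intro A hA x
    have hA' : ∀ x, (π * Equiv.swap u w) x ∈ A ↔ x ∈ A := (mem_filter_univ A).mp hA
    by_cases hxu : x = u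
    · subst hxu
      have := hA' w
      rw [Equiv.Perm.mul_apply, Equiv.swap_apply_right] at this
      rw [this, huw A hA]
    by_cases hxw : x = w
    · subst hxw
      have := hA' u
      rw [Equiv.Perm.mul_apply, Equiv.swap_apply_left] at this
      rw [this, huw A hA]
    · have := hA' x
      rwa [Equiv.Perm.mul_apply, Equiv.swap_apply_of_ne_of_ne hxu hxw] at this
  -- Sets invariant under the merged permutation contain both or neither of `u`, `w`. Toggling the
  -- `π`-cycle `C` of `u` yields equally many further `π`-invariant sets, which separate `u` from
  -- `w`.
  have hinj : Function.Injective fun A : Finset (Fin n) => symmDiff A C :=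
    symmDiff_left_injective C
  have hdisj : Disjoint I' (I'.image fun A => symmDiff A C) := by
    rw [disjoint_left]
    intro B hB hB'
    obtain ⟨A, hA, rfl⟩ := mem_image.mp hB'
    have h1 := huw A hA
    have h2 := huw _ hB
    have hu : u ∈ C := by simp [hC, Equiv.Perm.SameCycle.refl]
    have hw : w ∉ C := by simpa [hC] using h
    simp only [mem_symmDiff] at h2
    tauto
  have hsub : I' ∪ (I'.image fun A => symmDiff A C) ⊆
      ({A | ∀ x, π x ∈ A ↔ x ∈ A} : Finset (Finset (Fin n))) := by
    intro B hB
    rw [mem_filter_univ]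
    rcases mem_union.mp hB with hB | hB
    · exact hinv B hB
    · obtain ⟨A, hA, rfl⟩ := mem_image.mp hB
      intro x
      simp only [mem_symmDiff, hinv A hA x, hCi x]
  have := card_le_card hsub
  rw [card_union_of_disjoint hdisj, card_image_of_injective _ hinj] at this
  rw [← two_mul] at this
  exact this

/-- A permutation with a single cycle is followed by some tour. -/
theorem exists_tour_of_sameCycle {n : ℕ} (hn : 2 ≤ n) {π : Equiv.Perm (Fin n)}
    (h : ∀ u w, π.SameCycle u w) :
    ∃ σ : Equiv.Perm (Fin n), ∀ i, π (σ i) = σ (finRotate n i) := by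
  have hne : ∀ x, π x ≠ x := by
    intro x hx
    have : Nontrivial (Fin n) := Fin.nontrivial_iff_two_le.mpr hn
    obtain ⟨y, hy⟩ := exists_ne x
    exact hy (Equiv.Perm.SameCycle.eq_of_left (h x y) hx).symm
  have hc : π.IsCycle := ⟨⟨0, by omega⟩, hne _, fun y _ => h _ y⟩
  have hs : π.support = univ := by ext x; simpa using hne x
  have hr : (finRotate n).support = univ := support_finRotate_of_le hn
  obtain ⟨σ, hσ⟩ := isConj_iff.mp ((isCycle_finRotate_of_le hn).isConj hc (by rw [hs, hr]))
  refine ⟨σ, fun i => ?_⟩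
  rw [← hσ]
  simp

/-- A permutation with at most `2 ^ k` invariant sets is followed by some tour up to `2 * k`
exceptions. -/
theorem exists_tour_of_numInvariant_lt {n : ℕ} (hn : 2 ≤ n) (k : ℕ) (π : Equiv.Perm (Fin n))
    (h : numInvariant π < 2 ^ (k + 1)) :
    ∃ σ : Equiv.Perm (Fin n), #{i | π (σ i) ≠ σ (finRotate n i)} ≤ 2 * k := by
  induction k generalizing π with
  | zero => have := one_lt_numInvariant (by omega) π; omega
  | succ k ih =>
    by_cases hc : ∀ u w, π.SameCycle u w
    · obtain ⟨σ, hσ⟩ := exists_tour_of_sameCycle hn hc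
      exact ⟨σ, by simp [hσ]⟩
    · push Not at hc
      obtain ⟨u, w, huw⟩ := hc
      have h2 := two_mul_numInvariant_mul_swap_le huw
      obtain ⟨σ, hσ⟩ := ih (π * Equiv.swap u w) (by rw [pow_succ] at h; omega)
      refine ⟨σ, ?_⟩
      -- The permutation before the merge differs from the merged one only at `u` and `w`, so
      -- undoing the merge costs two exceptions.
      have hsub : ({i | π (σ i) ≠ σ (finRotate n i)} : Finset (Fin n)) ⊆
          ({i | (π * Equiv.swap u w) (σ i) ≠ σ (finRotate n i)} : Finset (Fin n)) ∪
          ({i | σ i ∈ ({u, w} : Finset (Fin n))} : Finset (Fin n)) := by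
        intro i
        simp only [mem_filter_univ, mem_union, mem_insert, mem_singleton]
        intro hi
        by_contra! hcon
        rw [Equiv.Perm.mul_apply, Equiv.swap_apply_of_ne_of_ne hcon.2.1 hcon.2.2] at hcon
        exact hi hcon.1
      have h3 := (card_le_card hsub).trans (card_union_le _ _)
      have h4 := card_filter_mem_le σ.injective ({u, w} : Finset (Fin n))
      have h5 := card_le_two (a := u) (b := w)
      omega

/-! ## The cost of tours -/

theorem hubDist_le_two {n : ℕ} (U : Finset (Fin n)) (π : Equiv.Perm (Fin n)) (x y : Fin n) :
    hubDist U π x y ≤ 2 := by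
  unfold hubDist hubAnswer
  split_ifs <;> omega

theorem hubDist_apply_le_one {n : ℕ} (U : Finset (Fin n)) (π : Equiv.Perm (Fin n)) (x : Fin n) :
    hubDist U π x (π x) ≤ 1 := by
  simp only [hubDist, hubAnswer, true_or, decide_true, or_true, if_true]
  split_ifs <;> omega

theorem tspCost_hubDist_le {n : ℕ} (hn : 2 ≤ n) (U : Finset (Fin n)) (π : Equiv.Perm (Fin n))
    (k : ℕ) (h : numInvariant π < 2 ^ (k + 1)) : tspCost (hubDist U π) ≤ n + 2 * k := by
  obtain ⟨σ, hσ⟩ := exists_tour_of_numInvariant_lt hn k π h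
  refine (ciInf_le (OrderBot.bddBelow _) σ).trans ?_
  have hle : ∀ i, hubDist U π (σ i) (σ (finRotate n i)) ≤
      1 + if π (σ i) ≠ σ (finRotate n i) then 1 else 0 := by
    intro i
    split_ifs with hi
    · exact hubDist_le_two ..
    · rw [not_not] at hi
      rw [← hi]
      exact hubDist_apply_le_one ..
  refine (sum_le_sum fun i _ => hle i).trans ?_
  rw [sum_add_distrib, ← card_filter]
  simpa using hσ

theorem finRotate_ne {n : ℕ} (hn : 2 ≤ n) (i : Fin n) : finRotate n i ≠ i := by
  have : i ∈ (finRotate n).support := by rw [support_finRotate_of_le hn]; exact mem_univ i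
  exact Equiv.Perm.mem_support.mp this

theorem two_mul_le_tourCost_hubDist {n : ℕ} (hn : 2 ≤ n) (U : Finset (Fin n))
    (π σ : Equiv.Perm (Fin n)) :
    2 * n ≤ tourCost (hubDist U π) σ + #{i | hubDist U π (σ i) (σ (finRotate n i)) = 1} := by
  rw [card_filter, tourCost, ← sum_add_distrib]
  have : ∀ i ∈ (univ : Finset (Fin n)), 2 ≤ hubDist U π (σ i) (σ (finRotate n i)) +
      if hubDist U π (σ i) (σ (finRotate n i)) = 1 then 1 else 0 := by
    intro i _
    have hne : σ i ≠ σ (finRotate n i) := fun h => finRotate_ne hn i (σ.injective h).symm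
    simp only [hubDist, hubAnswer, hne, if_false]
    split_ifs <;> simp_all
  have := card_nsmul_le_sum _ _ 2 this
  simpa [mul_comm] using this

theorem le_tspCost_hubDist {n : ℕ} (hn : 2 ≤ n) (U : Finset (Fin n)) (π : Equiv.Perm (Fin n)) :
    n ≤ tspCost (hubDist U π) := by
  refine le_ciInf fun σ => ?_
  have := two_mul_le_tourCost_hubDist hn U π σ
  have h2 := card_le_univ ({i | hubDist U π (σ i) (σ (finRotate n i)) = 1} : Finset (Fin n))
  rw [Fintype.card_fin] at h2
  omega

/-- For `ε > 1` the factor is below 1 while the optimum is positive; this disposes of the values of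
`ε` excluded by `exists_parameter`. -/
theorem not_isApproxTour_of_one_lt {n : ℕ} (hn : 2 ≤ n) (U : Finset (Fin n))
    (π σ : Equiv.Perm (Fin n)) {ε : ℝ} (hε : 1 < ε) :
    ¬ IsApproxTour (hubDist U π) (2 - ε) σ := by
  intro h
  have h1 : (tspCost (hubDist U π) : ℝ) ≤ tourCost (hubDist U π) σ := by
    exact_mod_cast ciInf_le (OrderBot.bddBelow _) σ
  have h2 : (2 : ℝ) ≤ tspCost (hubDist U π) := by
    exact_mod_cast hn.trans (le_tspCost_hubDist hn U π)
  unfold IsApproxTour at h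
  nlinarith

/-- A good tour has many edges of length `1`, if the permutation has few cycles. -/
theorem le_card_unit_edges_of_isApproxTour {n : ℕ} (hn : 2 ≤ n) (U : Finset (Fin n))
    (π σ : Equiv.Perm (Fin n)) (k : ℕ) (hk : numInvariant π < 2 ^ (k + 1)) {ε : ℝ} (hε : 0 ≤ ε)
    (h : IsApproxTour (hubDist U π) (2 - ε) σ) :
    ε * n - 4 * k ≤ (#{i | hubDist U π (σ i) (σ (finRotate n i)) = 1} : ℝ) := by
  have h1 : (2 * n : ℝ) ≤ tourCost (hubDist U π) σ +
      #{i | hubDist U π (σ i) (σ (finRotate n i)) = 1} := by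
    exact_mod_cast two_mul_le_tourCost_hubDist hn U π σ
  have h2 : (tspCost (hubDist U π) : ℝ) ≤ n + 2 * k := by
    exact_mod_cast tspCost_hubDist_le hn U π k hk
  have h3 : (n : ℝ) ≤ tspCost (hubDist U π) := by
    exact_mod_cast le_tspCost_hubDist hn U π
  unfold IsApproxTour at h
  nlinarith

/-! ## Good tours are rarely found by few queries -/

/-- Combines `Q.choose k ≤ Q ^ k / k!`, `k ^ k / k! ≤ exp 1 ^ k` with `exp 1 ≤ 11 / 4`, and a
falling factorial of at least `(M / 2) ^ k`. The 11 is chosen so that `11 / 4 * (2 / 11) = 1 / 2`.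
-/
theorem choose_mul_factorial_mul_two_pow_le {M Q k : ℕ} (hk : 2 * k ≤ M) (hQ : 11 * Q ≤ k * M) :
    Q.choose k * (M - k).factorial * 2 ^ k ≤ M.factorial := by
  rw [← Nat.factorial_mul_descFactorial (show k ≤ M by omega), mul_right_comm, mul_comm]
  refine Nat.mul_le_mul_left _ ?_
  have h1 : ((M : ℝ) / 2) ^ k ≤ M.descFactorial k := by
    refine le_trans ?_ (Nat.cast_le.mpr (Nat.pow_sub_le_descFactorial M k))
    push_cast
    gcongr
    rw [Nat.cast_sub (by omega)]
    have : (2 * k : ℝ) ≤ M := by exact_mod_cast hk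
    push_cast
    linarith
  have h2 : (Q.choose k : ℝ) ≤ (Q : ℝ) ^ k / k.factorial := Nat.choose_le_pow_div k Q
  have h3 : (k : ℝ) ^ k / k.factorial ≤ Real.exp 1 ^ k := by
    rw [← Real.exp_nat_mul, mul_one]
    exact Real.pow_div_factorial_le_exp (k : ℝ) (Nat.cast_nonneg k) k
  have hf : (0 : ℝ) < k.factorial := by exact_mod_cast k.factorial_pos
  have he : Real.exp 1 ≤ 11 / 4 := by have := Real.exp_one_lt_d9; linarith
  have hQ' : (Q : ℝ) ≤ k * M / 11 := by
    have : (11 * Q : ℝ) ≤ k * M := by exact_mod_cast hQ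
    linarith
  have h4 : (Q.choose k : ℝ) * 2 ^ k ≤ ((M : ℝ) / 2) ^ k := by
    calc (Q.choose k : ℝ) * 2 ^ k ≤ (Q : ℝ) ^ k / k.factorial * 2 ^ k := by gcongr
      _ ≤ ((k : ℝ) * M / 11) ^ k / k.factorial * 2 ^ k := by gcongr
      _ = (k : ℝ) ^ k / k.factorial * (M / 11 * 2) ^ k := by
        rw [mul_pow, mul_div_assoc, mul_pow]; ring
      _ ≤ (11 / 4) ^ k * (M / 11 * 2) ^ k := by
        gcongr
        exact h3.trans (by gcongr)
      _ = ((M : ℝ) / 2) ^ k := by rw [← mul_pow]; congr 1; ring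
  exact_mod_cast h4.trans h1

open Classical in
/-- A deterministic algorithm with few queries finds a good tour for at most a quarter of the
permutations. -/
theorem card_isApproxTour_le {N : ℕ} (hN : 2 ≤ N) {ε : ℝ} (hε : 0 ≤ ε)
    (F : Finset (Equiv.Perm (Fin N))) (U : Finset (Fin N)) (hU : #U ≤ 1)
    (hF : ∀ π ∈ F, ∀ ρ ∈ F, ∀ u ∈ U, π u = ρ u) (hFc : #F = (N - #U).factorial)
    (hFi : ∑ π ∈ F, numInvariant π ≤ 2 * (N + 1) * #F)
    {k q : ℕ} (hk : 2 * k ≤ N - 1) (hq : 11 * (2 * q + 2 * N) ≤ k * (N - 1))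
    (hkε : (6 * k + 2 : ℝ) ≤ ε * N) (hkN : 4 * (N + 2) ≤ 2 ^ k) (T : DetAlg N) :
    4 * #{π ∈ F | T.numQueries (hubDist U π) ≤ q ∧
      IsApproxTour (hubDist U π) (2 - ε) (T.tour (hubDist U π))} ≤ #F := by
  set S := {π ∈ F | T.numQueries (hubDist U π) ≤ q ∧
      IsApproxTour (hubDist U π) (2 - ε) (T.tour (hubDist U π))} with hS
  have hsub : S ⊆ {π ∈ F | (T.toArcTree U).depth π ≤ 2 * q + 2 * N ∧
        k ≤ #((T.toArcTree U).found π \ U)} ∪ {π ∈ F | 2 ^ (k + 1) ≤ numInvariant π} := by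
    intro π hπ
    obtain ⟨hπF, hπq, hπt⟩ := mem_filter.mp hπ
    rw [mem_union, mem_filter, mem_filter]
    by_cases hinv : 2 ^ (k + 1) ≤ numInvariant π
    · exact Or.inr ⟨hπF, hinv⟩
    refine Or.inl ⟨hπF, ?_, ?_⟩
    · have := T.depth_toArcTree_le U π
      omega
    · have h1 := le_card_unit_edges_of_isApproxTour hN U π _ k (not_le.mp hinv) hε hπt
      have h2 := T.card_unit_edges_le U π
      -- From `ε * N - 4 * k` and `6 * k + 2 ≤ ε * N`. Removing the at most 2 edges at the hub and
      -- halving leaves `k` found arcs.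
      have h3 : 2 * k + 2 ≤ #{i | hubDist U π (T.tour (hubDist U π) i)
          (T.tour (hubDist U π) (finRotate N i)) = 1} := by
        have : (2 * k + 2 : ℝ) ≤ #{i | hubDist U π (T.tour (hubDist U π) i)
          (T.tour (hubDist U π) (finRotate N i)) = 1} := by linarith
        exact_mod_cast this
      omega
  have hcard := (card_le_card hsub).trans (card_union_le _ _)
  have h1 := (T.toArcTree U).card_found_le F U (2 * q + 2 * N) k hF
  have h2 := card_large_numInvariant F (2 ^ (k + 1))
  have h3 := choose_mul_factorial_mul_two_pow_le (M := N - #U) (Q := 2 * q + 2 * N) (k := k)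
    (by omega) (hq.trans (Nat.mul_le_mul_left _ (by omega)))
  rw [← hFc] at h3
  have h4 := Nat.mul_le_mul_right (2 ^ k) h1
  have h5 := Nat.mul_le_mul_right (2 ^ k) hcard
  -- The permutations with many found arcs contribute `#F`, those with many cycles `(N + 1) * #F`.
  have h6 : #S * 2 ^ k ≤ (N + 2) * #F := by
    have h2' := h2.trans hFi
    rw [pow_succ, ← mul_assoc] at h2'
    rw [add_mul] at h5
    rw [pow_succ] at h5
    linarith
  have h7 : #S * (4 * (N + 2)) ≤ (N + 2) * #F := (Nat.mul_le_mul_left _ hkN).trans h6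
  exact Nat.le_of_mul_le_mul_left (show (N + 2) * (4 * #S) ≤ (N + 2) * #F by linarith)
    (Nat.succ_pos _)

theorem sq_le_two_pow {k : ℕ} (hk : 4 ≤ k) : k ^ 2 ≤ 2 ^ k := by
  induction k, hk using Nat.le_induction with
  | base => norm_num
  | succ k hk ih => rw [pow_succ 2 k]; nlinarith

/-- The choice is `k = ⌊ε N / 32⌋`, so `k (N - 1)` is at least `ε N ^ 2 / 128`, well above the `22 q
+ 22 N` required. The threshold `100000 / ε ^ 2` makes `k ^ 2`, and hence `2 ^ k`, exceed `4 (N +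
2)`. -/
theorem exists_parameter {ε : ℝ} (hε : 0 < ε) (hε1 : ε ≤ 1) {N : ℕ}
    (hN : 100000 / ε ^ 2 ≤ N) {q : ℕ} (hq : (q : ℝ) ≤ 1 / 10000 * ε * (N : ℝ) ^ 2) :
    ∃ k : ℕ, 2 * k ≤ N - 1 ∧ 11 * (2 * q + 2 * N) ≤ k * (N - 1) ∧
      (6 * k + 2 : ℝ) ≤ ε * N ∧ 4 * (N + 2) ≤ 2 ^ k := by
  have h0 : 100000 ≤ ε ^ 2 * N := by rwa [div_le_iff₀' (by positivity)] at hN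
  have hN0 : (0 : ℝ) ≤ N := Nat.cast_nonneg N
  have h1 : 100000 ≤ ε * N := by nlinarith
  have h2 : (100000 : ℝ) ≤ N := by nlinarith
  have hk1 := Nat.floor_le (show 0 ≤ ε * N / 32 by positivity)
  have hk2 := Nat.lt_floor_add_one (ε * N / 32)
  generalize ⌊ε * N / 32⌋₊ = k at hk1 hk2
  have hN1 : ((N - 1 : ℕ) : ℝ) = N - 1 := by
    rw [Nat.cast_sub, Nat.cast_one]
    exact_mod_cast (by linarith : (1 : ℝ) ≤ N)
  have hk3 : ε * N / 64 ≤ k := by linarith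
  refine ⟨k, ?_, ?_, by linarith, ?_⟩
  · have : (2 * k : ℝ) ≤ (N - 1 : ℕ) := by rw [hN1]; nlinarith
    exact_mod_cast this
  · have h3 : ε * N / 64 * (N / 2) ≤ k * (N - 1) := by gcongr; linarith
    have h4 : (N : ℝ) * 100000 ≤ N * (ε * N) := by gcongr
    have : (11 * (2 * q + 2 * N) : ℝ) ≤ k * (N - 1 : ℕ) := by rw [hN1]; nlinarith
    exact_mod_cast this
  · refine le_trans ?_ (sq_le_two_pow (k := k) ?_)
    · have h3 : (ε * N / 64) ^ 2 ≤ (k : ℝ) ^ 2 := by gcongr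
      have h4 : (N : ℝ) * 100000 ≤ N * (ε ^ 2 * N) := by gcongr
      have : (4 * (N + 2) : ℝ) ≤ (k : ℝ) ^ 2 := by nlinarith
      exact_mod_cast this
    · have : (4 : ℝ) ≤ k := by linarith
      exact_mod_cast this

/-! ## Randomized algorithms -/

open MeasureTheory in
/-- If almost every point lies in at most `K` of the sets, their measures sum up to at most `K`. -/
theorem sum_measureReal_le_of_ae_card_le {Ω ι : Type*} [MeasurableSpace Ω] (μ : Measure Ω)
    [IsProbabilityMeasure μ] (s : Finset ι) (E : ι → Set Ω)
    (hE : ∀ i, MeasurableSet (E i)) (K : ℝ) [∀ ω, DecidablePred fun i => ω ∈ E i]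
    (h : ∀ᵐ ω ∂μ, (#{i ∈ s | ω ∈ E i} : ℝ) ≤ K) : ∑ i ∈ s, μ.real (E i) ≤ K := by
  have hint : ∀ i ∈ s, Integrable ((E i).indicator (fun _ => (1 : ℝ))) μ := fun i _ =>
    (integrable_const 1).indicator (hE i)
  calc ∑ i ∈ s, μ.real (E i) = ∑ i ∈ s, ∫ ω, (E i).indicator (fun _ => (1 : ℝ)) ω ∂μ := by
        refine sum_congr rfl fun i _ => ?_
        rw [integral_indicator_const _ (hE i), smul_eq_mul, mul_one]
    _ = ∫ ω, ∑ i ∈ s, (E i).indicator (fun _ => (1 : ℝ)) ω ∂μ := (integral_finsetSum s hint).symm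
    _ ≤ ∫ _, K ∂μ := by
        refine integral_mono_ae (integrable_finsetSum s hint) (integrable_const K) ?_
        filter_upwards [h] with ω hω
        refine le_trans (le_of_eq ?_) hω
        rw [card_filter]
        push_cast
        exact sum_congr rfl fun i _ => by simp [Set.indicator_apply]
    _ = K := by simp

theorem RandAlg.measurableSet_isApproxTour {n : ℕ} (A : RandAlg n) (d : Fin n → Fin n → ℕ)
    (ρ : ℝ) : MeasurableSet {ω | IsApproxTour d ρ ((A.run ω).tour d)} := by
  have : {ω | IsApproxTour d ρ ((A.run ω).tour d)} =
      ⋃ σ ∈ {σ | IsApproxTour d ρ σ}, {ω | (A.run ω).tour d = σ} := by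
    ext ω
    simp
  rw [this]
  exact MeasurableSet.biUnion (Set.to_countable _) fun σ _ => A.measurable_tour d σ

/-- The lower bound for a random permutation from a family of permutations. -/
theorem RandAlg.exists_needsQueries_of_family {N : ℕ} {ε : ℝ} (hε : 0 < ε)
    (hN : 100000 / ε ^ 2 ≤ N) (hN2 : 2 ≤ N)
    (F : Finset (Equiv.Perm (Fin N))) (U : Finset (Fin N)) (hU : #U ≤ 1)
    (hF : ∀ π ∈ F, ∀ ρ ∈ F, ∀ u ∈ U, π u = ρ u) (hFc : #F = (N - #U).factorial)
    (hFi : ∑ π ∈ F, numInvariant π ≤ 2 * (N + 1) * #F) (A : RandAlg N)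
    (hA : (1 / 2 : ℝ) ≤ (∑ π ∈ F, A.successProb (hubDist U π) (2 - ε)) / #F) :
    ∃ π ∈ F, A.NeedsQueries (hubDist U π) (1 / 10000 * ε * (N : ℝ) ^ 2) := by
  classical
  have hF0 : (0 : ℝ) < #F := by rw [hFc]; exact_mod_cast Nat.factorial_pos _
  rw [le_div_iff₀ hF0] at hA
  rcases lt_or_ge 1 ε with hε1 | hε1
  · rw [sum_eq_zero] at hA
    · linarith
    · intro π _
      simp [RandAlg.successProb, not_isApproxTour_of_one_lt hN2 U π _ hε1]
  -- Otherwise almost every seed is a deterministic algorithm with few queries on all of `F`,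
  -- succeeding on at most a quarter of it; averaging over seeds contradicts success probability `1
  -- / 2`.
  by_contra! hcon
  have hle : ∑ π ∈ F, A.successProb (hubDist U π) (2 - ε) ≤ #F / 4 := by
    refine sum_measureReal_le_of_ae_card_le A.μ F _
      (fun π => A.measurableSet_isApproxTour (hubDist U π) (2 - ε)) _ ?_
    have hae : ∀ᵐ ω ∂A.μ, ∀ π ∈ F,
        ¬ (1 / 10000 * ε * (N : ℝ) ^ 2 ≤ ((A.run ω).numQueries (hubDist U π) : ℝ)) := by
      refine (MeasureTheory.ae_ball_iff F.countable_toSet).mpr ?_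
      intro π hπ
      rw [MeasureTheory.ae_iff]
      simpa [RandAlg.NeedsQueries] using hcon π hπ
    filter_upwards [hae] with ω hω
    obtain ⟨k, h1, h2, h3, h4⟩ := exists_parameter hε hε1 hN
      (Nat.floor_le (show 0 ≤ 1 / 10000 * ε * (N : ℝ) ^ 2 by positivity))
    have hdet := card_isApproxTour_le hN2 hε.le F U hU hF hFc hFi h1 h2 h3 h4 (A.run ω)
    have hsub : {π ∈ F | ω ∈ {ω | IsApproxTour (hubDist U π) (2 - ε)
          ((A.run ω).tour (hubDist U π))}} ⊆
        {π ∈ F | (A.run ω).numQueries (hubDist U π) ≤ ⌊1 / 10000 * ε * (N : ℝ) ^ 2⌋₊ ∧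
          IsApproxTour (hubDist U π) (2 - ε) ((A.run ω).tour (hubDist U π))} := by
      intro π hπ
      rw [mem_filter] at hπ ⊢
      exact ⟨hπ.1, Nat.le_floor (not_le.mp (hω π hπ.1)).le, hπ.2⟩
    have hc : 4 * #{π ∈ F | ω ∈ {ω | IsApproxTour (hubDist U π) (2 - ε)
          ((A.run ω).tour (hubDist U π))}} ≤ #F :=
      (Nat.mul_le_mul_left 4 (card_le_card hsub)).trans hdet
    rw [le_div_iff₀' (by norm_num)]
    exact_mod_cast hc
  linarith

/-! ## The random instances -/

theorem oneTwoDist_permGraph {n : ℕ} (π : Equiv.Perm (Fin n)) :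
    oneTwoDist (permGraph π) = hubDist ∅ π := by
  classical
  ext x y
  by_cases h : x = y
  · simp [oneTwoDist, hubDist, hubAnswer, h]
  · simp [oneTwoDist, hubDist, hubAnswer, h, permGraph]

theorem isOneTwoMetric_oneTwoDist {n : ℕ} (G : SimpleGraph (Fin n)) :
    IsOneTwoMetric (oneTwoDist G) where
  self u := by simp [oneTwoDist]
  symm u v := by
    by_cases h : G.Adj u v
    · simp [oneTwoDist, eq_comm (a := u) (b := v), h, h.symm]
    · have h' : ¬ G.Adj v u := fun e => h e.symm
      simp [oneTwoDist, eq_comm (a := u) (b := v), h, h']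
  one_or_two u v h := by
    simp only [oneTwoDist, h, if_false]
    split_ifs <;> simp

theorem addHub_adj_zero {n : ℕ} (G : SimpleGraph (Fin n)) {x : Fin (n + 1)} (hx : x ≠ 0) :
    (addHub G).Adj x 0 := by
  simp [addHub, hx]

theorem addHub_connected {n : ℕ} (G : SimpleGraph (Fin n)) : (addHub G).Connected := by
  have h : ∀ x, (addHub G).Reachable x 0 := by
    intro x
    by_cases hx : x = 0
    · rw [hx]
    · exact (addHub_adj_zero G hx).reachable
  exact ⟨fun x y => (h x).trans (h y).symm⟩

/-- The extension of a permutation of `1, …, n` that fixes `0`. -/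
def fixZero {n : ℕ} : Equiv.Perm (Fin n) ↪ Equiv.Perm (Fin (n + 1)) where
  toFun π := Equiv.Perm.decomposeFin.symm (0, π)
  inj' π ρ h := by simpa using h

@[simp] theorem fixZero_zero {n : ℕ} (π : Equiv.Perm (Fin n)) : fixZero π 0 = 0 :=
  Equiv.Perm.decomposeFin_symm_apply_zero 0 π

@[simp] theorem fixZero_succ {n : ℕ} (π : Equiv.Perm (Fin n)) (i : Fin n) :
    fixZero π i.succ = (π i).succ := by
  change Equiv.Perm.decomposeFin.symm (0, π) i.succ = _
  simp

theorem addHub_permGraph_adj {n : ℕ} (π : Equiv.Perm (Fin n)) {x y : Fin (n + 1)} (h : x ≠ y) :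
    (addHub (permGraph π)).Adj x y ↔ x = 0 ∨ y = 0 ∨ fixZero π x = y ∨ fixZero π y = x := by
  cases x using Fin.cases with
  | zero => simp [addHub, h]
  | succ i =>
    cases y using Fin.cases with
    | zero => simp [addHub]
    | succ j =>
      have hij : i ≠ j := fun e => h (by rw [e])
      simp [addHub, permGraph, hij, hij.symm, Fin.succ_ne_zero]
      tauto

/-- Two distinct non-adjacent vertices are joined by a path of length 2 through the hub, so the
shortest-path metric takes only the values 0, 1, 2. -/
theorem dist_addHub_permGraph {n : ℕ} (π : Equiv.Perm (Fin n)) :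
    (addHub (permGraph π)).dist = hubDist {0} (fixZero π) := by
  ext x y
  by_cases h : x = y
  · simp [hubDist, hubAnswer, h]
  have hadj := addHub_permGraph_adj π h
  simp only [hubDist, hubAnswer, h, if_false, mem_singleton, decide_eq_true_eq]
  split_ifs with hc
  · exact SimpleGraph.dist_eq_one_iff_adj.mpr (hadj.mpr hc)
  · have h0 : (addHub (permGraph π)).dist x y ≠ 0 := fun e =>
      h ((addHub_connected _).dist_eq_zero_iff.mp e)
    have h1 : (addHub (permGraph π)).dist x y ≠ 1 := fun e =>
      hc (hadj.mp (SimpleGraph.dist_eq_one_iff_adj.mp e))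
    have hx : x ≠ 0 := fun e => hc (Or.inl e)
    have hy : y ≠ 0 := fun e => hc (Or.inr (Or.inl e))
    have h2 := SimpleGraph.dist_le (.cons (addHub_adj_zero (permGraph π) hx)
      (.cons (addHub_adj_zero (permGraph π) hy).symm .nil))
    simp only [SimpleGraph.Walk.length_cons, SimpleGraph.Walk.length_nil] at h2
    omega

/-- An invariant set is determined by its trace on the old points and by whether it contains the
hub. This accounts for the factor 2 in the bound on `∑ numInvariant` required of a family. -/
theorem numInvariant_fixZero_le {n : ℕ} (π : Equiv.Perm (Fin n)) :
    numInvariant (fixZero π) ≤ 2 * numInvariant π := by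
  classical
  have h : #((univ : Finset Bool) ×ˢ
      ({A : Finset (Fin n) | ∀ x, π x ∈ A ↔ x ∈ A} : Finset (Finset (Fin n)))) =
      2 * numInvariant π := by
    rw [card_product]; rfl
  rw [← h]
  refine card_le_card_of_injOn
    (fun A => (decide (0 ∈ A), ({x | x.succ ∈ A} : Finset (Fin n)))) ?_ ?_
  · intro A hA
    have hA' : ∀ x, fixZero π x ∈ A ↔ x ∈ A := by simpa using hA
    simp only [coe_product, Set.mem_prod, mem_coe, mem_univ, true_and, mem_filter_univ]
    intro x
    rw [← fixZero_succ]
    exact hA' _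
  · intro A _ B _ hAB
    simp only [Prod.mk.injEq, decide_eq_decide] at hAB
    ext x
    cases x using Fin.cases with
    | zero => exact hAB.1
    | succ i => simpa using congrArg (i ∈ ·) hAB.2

theorem RandAlg.exists_needsQueries_oneTwo {n : ℕ} {ε : ℝ} (hε : 0 < ε)
    (hn : 100000 / ε ^ 2 ≤ n) (hn2 : 2 ≤ n) (A : RandAlg n)
    (hA : 1 / 2 ≤ (∑ π : Equiv.Perm (Fin n),
      A.successProb (oneTwoDist (permGraph π)) (2 - ε)) / n.factorial) :
    ∃ π : Equiv.Perm (Fin n),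
      A.NeedsQueries (oneTwoDist (permGraph π)) (1 / 10000 * ε * (n : ℝ) ^ 2) := by
  have hcard : #(univ : Finset (Equiv.Perm (Fin n))) = n.factorial := by
    rw [card_univ, Fintype.card_perm, Fintype.card_fin]
  simp only [oneTwoDist_permGraph] at hA ⊢
  obtain ⟨π, -, hπ⟩ := A.exists_needsQueries_of_family hε hn hn2 univ ∅ (by simp) (by simp)
    (by simpa using hcard)
    (by rw [sum_numInvariant, hcard, mul_assoc]; omega) (by rwa [hcard])
  exact ⟨π, hπ⟩

theorem RandAlg.exists_needsQueries_graphic {n : ℕ} {ε : ℝ} (hε : 0 < ε)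
    (hn : 100000 / ε ^ 2 ≤ n) (hn2 : 2 ≤ n) (A : RandAlg (n + 1))
    (hA : 1 / 2 ≤ (∑ π : Equiv.Perm (Fin n),
      A.successProb (addHub (permGraph π)).dist (2 - ε)) / n.factorial) :
    ∃ π : Equiv.Perm (Fin n),
      A.NeedsQueries (addHub (permGraph π)).dist (1 / 10000 * ε * ((n + 1 : ℕ) : ℝ) ^ 2) := by
  have hcard : #((univ : Finset (Equiv.Perm (Fin n))).map fixZero) = n.factorial := by
    rw [card_map, card_univ, Fintype.card_perm, Fintype.card_fin]
  simp only [dist_addHub_permGraph] at hA ⊢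
  obtain ⟨π, hπF, hπ⟩ := A.exists_needsQueries_of_family hε
    (hn.trans (by push_cast; linarith)) (by omega) (univ.map fixZero) {0} (by simp)
    (by
      intro π hπ ρ hρ u hu
      obtain ⟨π', -, rfl⟩ := mem_map.mp hπ
      obtain ⟨ρ', -, rfl⟩ := mem_map.mp hρ
      rw [mem_singleton.mp hu, fixZero_zero, fixZero_zero])
    (by simpa using hcard)
    (by
      rw [hcard, sum_map]
      refine (sum_le_sum fun π _ => numInvariant_fixZero_le π).trans ?_
      rw [← mul_sum, sum_numInvariant]
      nlinarith [n.factorial_pos])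
    (by rwa [hcard, sum_map])
  obtain ⟨π', -, rfl⟩ := mem_map.mp hπF
  exact ⟨π', hπ⟩

theorem le_average_perm {n : ℕ} {p : ℝ} (f : Equiv.Perm (Fin n) → ℝ) (hf : ∀ π, p ≤ f π) :
    p ≤ (∑ π, f π) / n.factorial := by
  rw [le_div_iff₀ (by exact_mod_cast n.factorial_pos)]
  have := card_nsmul_le_sum univ f p fun π _ => hf π
  rwa [card_univ, Fintype.card_perm, Fintype.card_fin, nsmul_eq_mul, mul_comm] at this

end TSPQuery

theorem mainTheorem12 :
    ∃ p c : ℝ, 0 < p ∧ p < 1 ∧ 0 < c ∧ ∀ ε : ℝ, 0 < ε → ∃ n₀ : ℕ, ∀ n : ℕ, n₀ ≤ n →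
      -- graphic TSP
      (∀ A : TSPQuery.RandAlg n,
        (∀ d, TSPQuery.IsGraphicMetric d → p ≤ A.successProb d (2 - ε)) →
        ∃ d, TSPQuery.IsGraphicMetric d ∧ A.NeedsQueries d (c * ε * (n : ℝ) ^ 2)) ∧
      -- (1,2)-TSP
      (∀ A : TSPQuery.RandAlg n,
        (∀ d, TSPQuery.IsOneTwoMetric d → p ≤ A.successProb d (2 - ε)) →
        ∃ d, TSPQuery.IsOneTwoMetric d ∧ A.NeedsQueries d (c * ε * (n : ℝ) ^ 2)) ∧
      -- graphic TSP on the cycle graph of a random permutation, with one more vertex that is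
      -- adjacent to all the others
      (∀ A : TSPQuery.RandAlg (n + 1),
        p ≤ (∑ π : Equiv.Perm (Fin n),
          A.successProb (TSPQuery.addHub (TSPQuery.permGraph π)).dist (2 - ε)) / n.factorial →
        ∃ π : Equiv.Perm (Fin n),
          A.NeedsQueries (TSPQuery.addHub (TSPQuery.permGraph π)).dist
            (c * ε * ((n + 1 : ℕ) : ℝ) ^ 2)) ∧
      -- (1,2)-TSP on the cycle graph of a random permutation
      (∀ A : TSPQuery.RandAlg n,
        p ≤ (∑ π : Equiv.Perm (Fin n),
          A.successProb (TSPQuery.oneTwoDist (TSPQuery.permGraph π)) (2 - ε)) / n.factorial →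
        ∃ π : Equiv.Perm (Fin n),
          A.NeedsQueries (TSPQuery.oneTwoDist (TSPQuery.permGraph π))
            (c * ε * (n : ℝ) ^ 2)) := by
  -- Any `p` above the `1 / 4` of `card_isApproxTour_le` would serve. The `+ 3` leaves at least two
  -- points after the hub is removed.
  refine ⟨1 / 2, 1 / 10000, by norm_num, by norm_num, by norm_num, fun ε hε =>
    ⟨⌈100000 / ε ^ 2⌉₊ + 3, fun n hn => ?_⟩⟩
  have hlarge : ∀ m : ℕ, ⌈100000 / ε ^ 2⌉₊ ≤ m → 100000 / ε ^ 2 ≤ (m : ℝ) := fun m hm =>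
    (Nat.le_ceil _).trans (Nat.cast_le.mpr hm)
  refine ⟨fun A hA => ?_, fun A hA => ?_, fun A hA => ?_, fun A hA => ?_⟩
  -- One of the `n` points serves as the hub. A guarantee on every instance implies one on average,
  -- so the worst-case bounds follow from the average-case ones.
  · obtain ⟨m, rfl⟩ : ∃ m, n = m + 1 := ⟨n - 1, by omega⟩
    have hgr : ∀ π : Equiv.Perm (Fin m),
        TSPQuery.IsGraphicMetric (TSPQuery.addHub (TSPQuery.permGraph π)).dist := fun π =>
      ⟨_, TSPQuery.addHub_connected _, rfl⟩
    obtain ⟨π, hπ⟩ := A.exists_needsQueries_graphic hε (hlarge m (by omega)) (by omega)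
      (TSPQuery.le_average_perm _ fun π => hA _ (hgr π))
    exact ⟨_, hgr π, hπ⟩
  · obtain ⟨π, hπ⟩ := A.exists_needsQueries_oneTwo hε (hlarge n (by omega)) (by omega)
      (TSPQuery.le_average_perm _ fun π => hA _ (TSPQuery.isOneTwoMetric_oneTwoDist _))
    exact ⟨_, TSPQuery.isOneTwoMetric_oneTwoDist _, hπ⟩
  · exact A.exists_needsQueries_graphic hε (hlarge n (by omega)) (by omega) hA
  · exact A.exists_needsQueries_oneTwo hε (hlarge n (by omega)) (by omega) hA
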